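/- Let $\mathbb K\in\{\mathbb R,\mathbb C\}$ and $m,n\in\mathbb N$. Write $\mathcal S_n=\mathcal S(\mathbb R^n,\mathbb K)$ for the Schwartz space and $\mathcal S_n'$ for the space of tempered distributions (continuous linear functionals $\mathcal S_n\to\mathbb K$). Let $\mathcal O_M^{(m)}$ be the ring (under pointwise operations) of all smooth functions $f:\mathbb R^m\to\mathbb K$ such that $f\varphi\in\mathcal S_m$ for every $\varphi\in\mathcal S_m$. An $\mathcal S$-family is a family $v=(v_p)_{p\in\mathbb R^m}$ in $\mathcal S_n'$ such that, for every $\varphi\in\mathcal S_n$, the function $\widehat v(\varphi):p\mapsto v_p(\varphi)$ belongs to $\mathcal S_m$; the operator $\widehat v:\mathcal S_n\to\mathcal S_m$ is then linear and continuous. For $a\in\mathcal S_m'$ the superposition of $v$ with coefficients $a$ is $\int_{\mathbb R^m}a\,v:=a\circ\widehat v\in\mathcal S_n'$. The family $v$ is an $\mathcal S$-basis of a linear subspace $V\subseteq\mathcal S_n'$ if it is $\mathcal S$-linearly independent (that is, $\int_{\mathbb R^m}a\,v=0$ implies $a=0$) and its $\mathcal S$-linear hull $\{\int_{\mathbb R^m}a\,v: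 a\in\mathcal S_m'\}$ equals $V$. For $f\in\mathcal O_M^{(m)}$ the product $fv:=(f(p)v_p)_{p\in\mathbb R^m}$ is again an $\mathcal S$-family. Theorem. Let $V$ be a weak*-closed linear subspace of $\mathcal S_n'$, let $e=(e_p)_{p\in\mathbb R^m}$ be an $\mathcal S$-basis of $V$, and let $f\in\mathcal O_M^{(m)}$. Then the family $fe$ is an $\mathcal S$-basis of $V$ if and only if $f$ is an invertible element of the ring $\mathcal O_M^{(m)}$. -/

import Mathlib

open scoped SchwartzMap Topology ContDiff LineDeriv
open Filter

/-- The Schwartz space is complete. -/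
instance SchwartzMap.completeSpace_of_complete {E F : Type*} [NormedAddCommGroup E]
    [NormedSpace ℝ E] [NormedAddCommGroup F] [NormedSpace ℝ F] [CompleteSpace F] :
    CompleteSpace 𝓢(E, F) := by
  have hgen : (uniformity 𝓢(E, F)).IsCountablyGenerated :=
    IsUniformAddGroup.uniformity_countably_generated
  let S : ℕ → Seminorm ℝ 𝓢(E, F) := fun N => (Finset.Iic (N, N)).sup (schwartzSeminormFamily ℝ E F)
  refine UniformSpace.complete_of_convergent_controlled_sequences
    (fun N => {p | S N (p.2 - p.1) < (1 / 2 : ℝ) ^ N}) (fun N => ?_) (fun u hu => ?_)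
  · rw [uniformity_eq_comap_nhds_zero]
    refine ⟨(S N).ball 0 ((1 / 2 : ℝ) ^ N), ?_, fun p hp => ?_⟩
    · exact (schwartz_withSeminorms ℝ E F).hasBasis_zero_ball.mem_of_mem (i := (_, _))
        (by positivity)
    · simpa [Seminorm.mem_ball] using! hp
  · have hS : ∀ (k l N : ℕ) (f : 𝓢(E, F)), k ≤ N → l ≤ N →
        SchwartzMap.seminorm ℝ k l f ≤ S N f := by
      intro k l N f hk hl
      have : schwartzSeminormFamily ℝ E F (k, l) ≤ S N :=
        Finset.le_sup (f := schwartzSeminormFamily ℝ E F) (Finset.mem_Iic.2 ⟨hk, hl⟩)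
      exact this f
    have hd : ∀ k l N j : ℕ, k ≤ N → l ≤ N → N ≤ j →
        SchwartzMap.seminorm ℝ k l (u j - u N) ≤ (1 / 2 : ℝ) ^ N := fun k l N j hk hl hj =>
      (hS k l N _ hk hl).trans (le_of_lt (hu N N j le_rfl hj))
    let d : ℕ → 𝓢(E, F) := fun i => u (i + 1) - u i
    let v : ℕ → ℕ → ℝ := fun l i => SchwartzMap.seminorm ℝ 0 l (d i)
    have hv : ∀ l, Summable (v l) := fun l => by
      refine Summable.of_norm_bounded_eventually_nat (summable_geometric_two) ?_
      filter_upwards [eventually_ge_atTop l] with i hi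
      rw [Real.norm_of_nonneg (apply_nonneg _ _)]
      exact hd 0 l i (i + 1) (Nat.zero_le _) hi (Nat.le_succ _)
    have hb : ∀ (l i : ℕ) (x : E), ‖iteratedFDeriv ℝ l (d i) x‖ ≤ v l i := fun l i x =>
      SchwartzMap.norm_iteratedFDeriv_le_seminorm ℝ (d i) l x
    have hG : ContDiff ℝ ∞ (fun x => ∑' i, d i x) :=
      contDiff_tsum (N := ⊤) (v := v) (fun i => (d i).smooth _) (fun l _ => hv l)
        (fun l i x _ => hb l i x)
    let g : E → F := fun x => u 0 x + ∑' i, d i x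
    have hg : ContDiff ℝ ∞ g := ((u 0).smooth ⊤).add hG
    have hsub : ∀ (l : ℕ) (a b : 𝓢(E, F)) (x : E), iteratedFDeriv ℝ l (a - b : 𝓢(E, F)) x =
        iteratedFDeriv ℝ l a x - iteratedFDeriv ℝ l b x := fun l a b x => by
      have h : ((a - b : 𝓢(E, F)) : E → F) = fun y => a y - b y := rfl
      rw [h]
      exact iteratedFDeriv_sub_apply ((a.smooth l).contDiffAt) ((b.smooth l).contDiffAt)
    have hlim : ∀ (l : ℕ) (x : E), Tendsto (fun j => iteratedFDeriv ℝ l (u j) x) atTop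
        (𝓝 (iteratedFDeriv ℝ l g x)) := by
      intro l x
      have h1 : iteratedFDeriv ℝ l g x =
          iteratedFDeriv ℝ l (u 0) x + ∑' i, iteratedFDeriv ℝ l (d i) x := by
        rw [← iteratedFDeriv_tsum_apply (N := ⊤) (v := v) (fun i => (d i).smooth _)
          (fun l _ => hv l) (fun l i x _ => hb l i x) le_top]
        exact iteratedFDeriv_add_apply (((u 0).smooth l).contDiffAt)
          ((hG.of_le (by exact_mod_cast le_top)).contDiffAt)
      have h2 : Summable fun i => iteratedFDeriv ℝ l (d i) x :=
        Summable.of_norm_bounded (hv l) fun i => hb l i x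
      rw [h1]
      refine (h2.hasSum.tendsto_sum_nat.const_add (iteratedFDeriv ℝ l (u 0) x)).congr fun j => ?_
      have : ∀ i, iteratedFDeriv ℝ l (d i) x =
          iteratedFDeriv ℝ l (u (i + 1)) x - iteratedFDeriv ℝ l (u i) x := fun i => hsub l _ _ x
      simp only [this, Finset.sum_range_sub (fun i => iteratedFDeriv ℝ l (u i) x)]
      abel
    have hest : ∀ (k l N : ℕ) (x : E), k ≤ N → l ≤ N →
        ‖x‖ ^ k * ‖iteratedFDeriv ℝ l g x - iteratedFDeriv ℝ l (u N) x‖ ≤ (1 / 2 : ℝ) ^ N := by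
      intro k l N x hk hl
      refine le_of_tendsto ((((hlim l x).sub_const _).norm).const_mul (‖x‖ ^ k)) ?_
      filter_upwards [eventually_ge_atTop N] with j hj
      rw [← hsub]
      exact (SchwartzMap.le_seminorm ℝ k l _ x).trans (hd k l N j hk hl hj)
    let G : 𝓢(E, F) :=
      { toFun := g
        smooth' := hg
        decay' := fun k l => by
          obtain ⟨C, -, hC⟩ := (u (max k l)).decay k l
          refine ⟨(1 / 2 : ℝ) ^ (max k l) + C, fun x => ?_⟩
          have := hest k l (max k l) x (le_max_left _ _) (le_max_right _ _)
          calc ‖x‖ ^ k * ‖iteratedFDeriv ℝ l g x‖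
              ≤ ‖x‖ ^ k * (‖iteratedFDeriv ℝ l g x - iteratedFDeriv ℝ l (u (max k l)) x‖
                + ‖iteratedFDeriv ℝ l (u (max k l)) x‖) := by
                gcongr
                simpa using norm_add_le (iteratedFDeriv ℝ l g x -
                  iteratedFDeriv ℝ l (u (max k l)) x) (iteratedFDeriv ℝ l (u (max k l)) x)
            _ ≤ _ := by rw [mul_add]; exact add_le_add this (hC x) }
    refine ⟨G, ((schwartz_withSeminorms ℝ E F).tendsto_nhds_atTop u G).2 ?_⟩
    rintro ⟨k, l⟩ ε hε
    obtain ⟨M, hM⟩ := exists_pow_lt_of_lt_one hε (by norm_num : (1 / 2 : ℝ) < 1)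
    refine ⟨max M (max k l), fun N hN => ?_⟩
    have hMN : M ≤ N := (le_max_left _ _).trans hN
    have hkN : k ≤ N := (le_max_left _ _).trans ((le_max_right _ _).trans hN)
    have hlN : l ≤ N := (le_max_right _ _).trans ((le_max_right _ _).trans hN)
    refine lt_of_le_of_lt ?_ hM
    refine (SchwartzMap.seminorm_le_bound ℝ k l (u N - G) (by positivity) fun x => ?_).trans
      (pow_le_pow_of_le_one (by norm_num) (by norm_num) hMN)
    rw [hsub, norm_sub_rev]
    exact hest k l N x hkN hlN

/-- A linear map between Schwartz spaces is continuous as soon as all its point evaluations are. -/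
theorem SchwartzMap.continuous_of_eval {𝕜 E D : Type*} [RCLike 𝕜] [NormedAddCommGroup E]
    [NormedSpace ℝ E] [NormedAddCommGroup D] [NormedSpace ℝ D]
    (A : 𝓢(E, 𝕜) →ₗ[𝕜] 𝓢(D, 𝕜)) (hA : ∀ p, Continuous fun φ => A φ p) : Continuous A := by
  have hgen : (uniformity 𝓢(E, 𝕜)).IsCountablyGenerated :=
    IsUniformAddGroup.uniformity_countably_generated
  have hder : ∀ (l : ℕ) (y : Fin l → D) (p : D), Continuous fun φ => (∂^{y} (A φ)) p := by
    intro l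
    induction l with
    | zero => intro y p; simpa using hA p
    | succ l ih =>
      intro y p
      let ev : D → 𝓢(E, 𝕜) →L[𝕜] 𝕜 := fun q =>
        { toFun := fun φ => (∂^{Fin.tail y} (A φ)) q
          map_add' := fun φ ψ => by simp [LineDeriv.iteratedLineDerivOp_add]
          map_smul' := fun c φ => by simp [LineDeriv.iteratedLineDerivOp_smul]
          cont := ih _ q }
      let t : ℕ → ℝ := fun k => 1 / ((k : ℝ) + 1)
      have ht : Tendsto t atTop (𝓝[≠] 0) :=
        tendsto_nhdsWithin_iff.2 ⟨tendsto_one_div_add_atTop_nhds_zero_nat,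
          Eventually.of_forall fun k => by
            have : (1 : ℝ) / ((k : ℝ) + 1) ≠ 0 := by positivity
            exact this⟩
      let g : ℕ → 𝓢(E, 𝕜) →L[𝕜] 𝕜 := fun k => ((t k)⁻¹ : 𝕜) • (ev (p + t k • y 0) - ev p)
      have hg : Tendsto (fun k φ => g k φ) atTop (𝓝 fun φ => (∂^{y} (A φ)) p) := by
        rw [tendsto_pi_nhds]
        intro φ
        rw [LineDeriv.iteratedLineDerivOp_succ_left, SchwartzMap.lineDerivOp_apply]
        have hl := ((∂^{Fin.tail y} (A φ)).differentiableAt (x := p)).lineDifferentiableAt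
          (v := y 0) |>.hasLineDerivAt
        have := (hasLineDerivAt_iff_tendsto_slope_zero.1 hl).comp ht
        refine this.congr fun k => ?_
        simp [g, ev, RCLike.real_smul_eq_coe_mul]
      exact (continuousLinearMapOfTendsto g hg).continuous
  refine (schwartz_withSeminorms 𝕜 D 𝕜).continuous_of_continuous_comp A fun ⟨k, l⟩ => ?_
  refine Seminorm.continuous_of_lowerSemicontinuous _ ?_
  rw [lowerSemicontinuous_iff_isClosed_preimage]
  intro c
  by_cases hc : 0 ≤ c
  · have : (((schwartzSeminormFamily 𝕜 D 𝕜 (k, l)).comp A) : 𝓢(E, 𝕜) → ℝ) ⁻¹' Set.Iic c =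
        ⋂ p : D, ⋂ y : Fin l → D, {φ | ‖p‖ ^ k * ‖(∂^{y} (A φ)) p‖ ≤ c * ∏ i, ‖y i‖} := by
      ext φ
      simp only [Set.mem_preimage, Set.mem_Iic, Set.mem_iInter, Set.mem_ofPred_eq,
        SchwartzMap.iteratedLineDerivOp_eq_iteratedFDeriv, Seminorm.comp_apply,
        schwartzSeminormFamily_apply]
      constructor
      · intro h p y
        have h1 := (SchwartzMap.le_seminorm 𝕜 k l (A φ) p).trans h
        calc _ ≤ ‖p‖ ^ k * (‖iteratedFDeriv ℝ l (A φ) p‖ * ∏ i, ‖y i‖) := by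
              gcongr; exact ContinuousMultilinearMap.le_opNorm _ _
          _ = (‖p‖ ^ k * ‖iteratedFDeriv ℝ l (A φ) p‖) * ∏ i, ‖y i‖ := by ring
          _ ≤ _ := by gcongr
      · intro h
        refine SchwartzMap.seminorm_le_bound 𝕜 k l _ hc fun p => ?_
        have : ‖(‖p‖ ^ k) • iteratedFDeriv ℝ l (A φ) p‖ ≤ c :=
          ContinuousMultilinearMap.opNorm_le_bound hc fun y => by
            simpa [norm_smul] using h p y
        simpa [norm_smul] using this
    rw [this]
    exact isClosed_iInter fun p => isClosed_iInter fun y =>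
      isClosed_le (continuous_const.mul (hder l y p).norm) continuous_const
  · convert isClosed_empty
    ext φ
    simp only [Set.mem_preimage, Set.mem_Iic, Set.mem_empty_iff_false, iff_false, not_le]
    exact lt_of_lt_of_le (not_le.1 hc) (apply_nonneg _ _)

/-- The Schwartz space `𝓢_n = 𝓢(ℝⁿ, 𝕜)` of test functions. -/
abbrev TestSpace (𝕜 : Type*) [RCLike 𝕜] (n : ℕ) : Type _ :=
  𝓢(EuclideanSpace ℝ (Fin n), 𝕜)

/-- The space `𝓢'_n` of tempered distributions on `ℝⁿ` with values in `𝕜`, with the weak* topology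
(pointwise convergence on test functions). -/
abbrev TempDist (𝕜 : Type*) [RCLike 𝕜] (n : ℕ) : Type _ :=
  TestSpace 𝕜 n →Lₚₜ[𝕜] 𝕜

/-- The algebra `𝒪_M(ℝᵐ, 𝕜)` of smooth functions `f` such that `f φ` is a Schwartz function for
every Schwartz function `φ`, with the pointwise operations. -/
def multiplierAlgebra (𝕜 : Type*) [RCLike 𝕜] (m : ℕ) :
    Subalgebra 𝕜 (EuclideanSpace ℝ (Fin m) → 𝕜) where
  carrier := {f | ContDiff ℝ ∞ f ∧
    ∀ φ : TestSpace 𝕜 m, ∃ ψ : TestSpace 𝕜 m, ∀ p, ψ p = f p * φ p}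
  mul_mem' := by
    rintro f g ⟨hf, hf'⟩ ⟨hg, hg'⟩
    refine ⟨hf.mul hg, fun φ => ?_⟩
    obtain ⟨ψ, hψ⟩ := hg' φ
    obtain ⟨χ, hχ⟩ := hf' ψ
    exact ⟨χ, fun p => by rw [hχ, hψ, Pi.mul_apply, mul_assoc]⟩
  add_mem' := by
    rintro f g ⟨hf, hf'⟩ ⟨hg, hg'⟩
    refine ⟨hf.add hg, fun φ => ?_⟩
    obtain ⟨ψ, hψ⟩ := hf' φ
    obtain ⟨χ, hχ⟩ := hg' φ
    exact ⟨ψ + χ, fun p => by rw [add_apply, hψ, hχ, Pi.add_apply, add_mul]⟩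
  algebraMap_mem' := fun c => ⟨contDiff_const, fun φ => ⟨c • φ, fun _ => rfl⟩⟩

/-- An `𝓢`-family in `𝓢'_n` indexed by `ℝᵐ`: a family `v` of tempered distributions such that, for
every test function `φ`, the function `p ↦ v_p(φ)` is a Schwartz function on `ℝᵐ`. -/
structure SchwartzFamily (𝕜 : Type*) [RCLike 𝕜] (m n : ℕ) where
  toFun : EuclideanSpace ℝ (Fin m) → TempDist 𝕜 n
  exists_schwartz : ∀ φ : TestSpace 𝕜 n, ∃ ψ : TestSpace 𝕜 m, ∀ p, ψ p = toFun p φ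

namespace SchwartzFamily

variable {𝕜 : Type*} [RCLike 𝕜] {m n : ℕ}

/-- The operator `v^ : 𝓢_n → 𝓢_m` of an `𝓢`-family, `v^(φ)(p) = v_p(φ)`, as a linear map. -/
noncomputable def hatₗ (v : SchwartzFamily 𝕜 m n) : TestSpace 𝕜 n →ₗ[𝕜] TestSpace 𝕜 m where
  toFun φ := (v.exists_schwartz φ).choose
  map_add' φ ψ := by
    ext p
    rw [add_apply, (v.exists_schwartz _).choose_spec, (v.exists_schwartz _).choose_spec,
      (v.exists_schwartz _).choose_spec, map_add]
  map_smul' c φ := by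
    ext p
    rw [smul_apply, (v.exists_schwartz _).choose_spec, (v.exists_schwartz _).choose_spec, map_smul,
      RingHom.id_apply]

theorem hatₗ_apply (v : SchwartzFamily 𝕜 m n) (φ : TestSpace 𝕜 n) (p : EuclideanSpace ℝ (Fin m)) :
    v.hatₗ φ p = v.toFun p φ :=
  (v.exists_schwartz φ).choose_spec p

/-- The operator `v^ : 𝓢_n → 𝓢_m` of an `𝓢`-family, `v^(φ)(p) = v_p(φ)`; it is continuous. -/
noncomputable def hat (v : SchwartzFamily 𝕜 m n) : TestSpace 𝕜 n →L[𝕜] TestSpace 𝕜 m where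
  toLinearMap := v.hatₗ
  cont := SchwartzMap.continuous_of_eval v.hatₗ fun p => by
    simp only [hatₗ_apply]
    exact (v.toFun p).continuous

theorem hat_apply (v : SchwartzFamily 𝕜 m n) (φ : TestSpace 𝕜 n) (p : EuclideanSpace ℝ (Fin m)) :
    v.hat φ p = v.toFun p φ :=
  v.hatₗ_apply φ p

/-- The superposition operator `𝓢'_m → 𝓢'_n`, `a ↦ ∫ a v`: the transpose `a ↦ a ∘ v^` of `v^`. -/
noncomputable def superposition (v : SchwartzFamily 𝕜 m n) : TempDist 𝕜 m →L[𝕜] TempDist 𝕜 n :=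
  PointwiseConvergenceCLM.precomp 𝕜 v.hat

theorem superposition_apply_apply (v : SchwartzFamily 𝕜 m n) (a : TempDist 𝕜 m)
    (φ : TestSpace 𝕜 n) : v.superposition a φ = a (v.hat φ) := rfl

/-- `v` is `𝓢`-linearly independent: `∫ a v = 0` only for `a = 0`. -/
def SLinearIndependent (v : SchwartzFamily 𝕜 m n) : Prop :=
  ∀ a : TempDist 𝕜 m, v.superposition a = 0 → a = 0

/-- The `𝓢`-linear hull of `v`: the set of all superpositions `∫ a v`, `a ∈ 𝓢'_m`. -/
noncomputable def sSpan (v : SchwartzFamily 𝕜 m n) : Submodule 𝕜 (TempDist 𝕜 n) :=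
  LinearMap.range v.superposition.toLinearMap

/-- `v` is an `𝓢`-basis of `V`: it is `𝓢`-linearly independent and its `𝓢`-linear hull is `V`. -/
def IsSBasis (v : SchwartzFamily 𝕜 m n) (V : Submodule 𝕜 (TempDist 𝕜 n)) : Prop :=
  v.SLinearIndependent ∧ v.sSpan = V

/-- The product `f v = (f(p) v_p)_p` of an `𝓢`-family by a function `f ∈ 𝒪_M(ℝᵐ, 𝕜)`. -/
noncomputable instance instSMul : SMul (multiplierAlgebra 𝕜 m) (SchwartzFamily 𝕜 m n) where
  smul f v :=
    { toFun := fun p => f.1 p • v.toFun p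
      exists_schwartz := fun φ => by
        obtain ⟨ψ, hψ⟩ := f.2.2 (v.hat φ)
        exact ⟨ψ, fun p => by rw [hψ, hat_apply]; rfl⟩ }

theorem smul_toFun (f : multiplierAlgebra 𝕜 m) (v : SchwartzFamily 𝕜 m n)
    (p : EuclideanSpace ℝ (Fin m)) : (f • v).toFun p = f.1 p • v.toFun p := rfl

end SchwartzFamily

/-!
Let `M` be the operator of multiplication by `f` on `𝓢_m`. Since the operator of `f • e` is `M ∘ e^`,
the superposition operator of `f • e` is the composition of the transpose of `M` with the
superposition operator of `e`. As `e` is `𝓢`-linearly independent, `f • e` is an `𝓢`-basis of the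
hull of `e` exactly when the transpose `a ↦ a ∘ M` of `M` is a bijection of `𝓢'_m`.

If `f` is invertible, composition with the operator of multiplication by `f⁻¹` inverts this
transpose. For the converse, a continuous linear map `T : E → F` between Fréchet spaces whose
transpose is bijective is surjective (`ContinuousLinearMap.surjective_of_dual_bijective`):

* surjectivity of the transpose and the uniform boundedness principle show that `T` induces the
  topology of `E` (`ContinuousLinearMap.isInducing_of_dual_surjective`), so the range of `T` is
  complete, hence closed;
* injectivity of the transpose and the Hahn-Banach theorem show that the range of `T` is dense
  (`ContinuousLinearMap.denseRange_of_dual_injective`).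

So `M` is surjective: every `φ ∈ 𝓢_m` is of the form `f ψ` with `ψ ∈ 𝓢_m`. Taking a bump function
around a point for `φ` shows that `f` has no zero. Hence `f⁻¹` is smooth and `f⁻¹ φ = ψ ∈ 𝓢_m`, that
is, `f⁻¹` belongs to `𝒪_M`.
-/

/-! ### Continuous linear maps with bijective transpose -/

/-- A family which is bounded under every linear functional dominated by a seminorm is bounded in
that seminorm. This is the uniform boundedness principle in the dual of the space seminormed by
`p`, which is complete. -/
theorem Seminorm.bounded_of_forall_dual_bounded {𝕜 E ι : Type*} [RCLike 𝕜] [AddCommGroup E]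
    [Module 𝕜 E] (p : Seminorm 𝕜 E) (u : ι → E)
    (h : ∀ g : E →ₗ[𝕜] 𝕜, (∃ C : ℝ, ∀ x, ‖g x‖ ≤ C * p x) → ∃ C : ℝ, ∀ i, ‖g (u i)‖ ≤ C) :
    ∃ C : ℝ, ∀ i, p (u i) ≤ C := by
  let _ : SeminormedAddCommGroup E := p.toSeminormedAddCommGroup
  let _ : NormedSpace 𝕜 E := { norm_smul_le := fun a b => le_of_eq (map_smul_eq_mul p a b) }
  obtain ⟨C, hC⟩ := banach_steinhaus
    (g := fun i => NormedSpace.inclusionInDoubleDualLi (E := E) 𝕜 (u i))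
    (fun g : StrongDual 𝕜 E => h g.toLinearMap ⟨‖g‖, fun x => g.le_opNorm x⟩)
  refine ⟨C, fun i => ?_⟩
  have := hC i
  rwa [LinearIsometry.norm_map] at this

namespace ContinuousLinearMap

variable {𝕜 E F ι : Type*} [RCLike 𝕜] [AddCommGroup E] [Module 𝕜 E] [AddCommGroup F] [Module 𝕜 F]

/-- If every continuous functional on `E` factors through `T`, then `T` induces the topology of
`E`. -/
theorem isInducing_of_dual_surjective [TopologicalSpace E] [TopologicalSpace F]
    [IsTopologicalAddGroup F] [ContinuousSMul 𝕜 F] [FirstCountableTopology F]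
    {p : SeminormFamily 𝕜 E ι} (hp : WithSeminorms p) (T : E →L[𝕜] F)
    (hT : ∀ a : E →L[𝕜] 𝕜, ∃ b : F →L[𝕜] 𝕜, ∀ x, b (T x) = a x) :
    Topology.IsInducing T := by
  have := hp.topologicalAddGroup
  have := hp.continuousSMul
  refine IsTopologicalAddGroup.isInducing_iff_nhds_zero.2 (le_antisymm ?_ ?_)
  · rw [← tendsto_iff_comap]
    simpa using T.continuous.tendsto 0
  rw [hp.hasBasis_zero_ball.ge_iff]
  rintro ⟨s, r⟩ hr
  replace hr : 0 < r := hr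
  set q : Seminorm 𝕜 E := s.sup p
  have hq : Continuous q := 
    Seminorm.continuous (r := 1) (hp.hasBasis_zero_ball.mem_of_mem (i := (s, 1)) one_pos)
  by_contra hmem
  obtain ⟨V, hV⟩ := (𝓝 (0 : F)).exists_antitone_basis
  -- Otherwise there are `x k` with `q (x k)` bounded below and `k • T (x k)` tending to zero. Then
  -- `k • x k` is weakly bounded, because every functional on `E` factors through `T`.
  have hex : ∀ k : ℕ, ∃ x : E, (k : 𝕜) • T x ∈ V k ∧ r ≤ q x := by
    intro k
    by_contra! hk
    refine hmem ⟨(fun y => (k : 𝕜) • y) ⁻¹' V k, ?_, fun x hx => ?_⟩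
    · have hc : Continuous fun y : F => (k : 𝕜) • y := continuous_const_smul _
      have ht := hc.tendsto 0
      rw [smul_zero] at ht
      exact ht (hV.mem k)
    · simpa [Seminorm.mem_ball] using hk x hx
  choose x hxV hxr using hex
  have hlim : Tendsto (fun k : ℕ => T ((k : 𝕜) • x k)) atTop (𝓝 0) := by
    simp only [map_smul]
    exact hV.tendsto hxV
  obtain ⟨C, hC⟩ := q.bounded_of_forall_dual_bounded (fun k : ℕ => (k : 𝕜) • x k) <| by
    rintro g ⟨c, hc⟩
    have hg : Continuous g := by
      refine continuous_of_continuousAt_zero g ?_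
      have h0 : Tendsto (fun y => c * q y) (𝓝 0) (𝓝 0) := by
        simpa using (hq.const_mul c).tendsto 0
      simpa [ContinuousAt] using squeeze_zero_norm hc h0
    obtain ⟨b, hb⟩ := hT ⟨g, hg⟩
    have hbl : Tendsto (fun k : ℕ => b (T ((k : 𝕜) • x k))) atTop (𝓝 0) := by
      have h0 := b.continuous.tendsto 0
      rw [map_zero] at h0
      exact h0.comp hlim
    obtain ⟨C, hC⟩ := hbl.norm.bddAbove_range
    exact ⟨C, fun k => by simpa [hb] using hC ⟨k, rfl⟩⟩
  obtain ⟨k, hk⟩ := exists_nat_gt (C / r)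
  have h1 := hC k
  rw [map_smul_eq_mul, RCLike.norm_natCast] at h1
  have h2 : (k : ℝ) * r ≤ k * q (x k) := by gcongr; exact hxr k
  rw [div_lt_iff₀ hr] at hk
  linarith

/-- If `b ∘ T = 0` only for the zero functional `b`, then `T` has dense range. -/
theorem denseRange_of_dual_injective [TopologicalSpace E] [TopologicalSpace F]
    [IsTopologicalAddGroup F] [ContinuousSMul 𝕜 F] [Module ℝ F] [IsScalarTower ℝ 𝕜 F]
    [LocallyConvexSpace ℝ F] (T : E →L[𝕜] F)
    (hT : ∀ b : F →L[𝕜] 𝕜, (∀ x, b (T x) = 0) → b = 0) : DenseRange T := by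
  intro y
  by_contra hy
  let K : Submodule 𝕜 F := (LinearMap.range T.toLinearMap).topologicalClosure
  have hyK : y ∉ (K : Set F) := by
    rw [Submodule.topologicalClosure_coe]
    exact hy
  obtain ⟨b, c, hlt, hgt⟩ := RCLike.geometric_hahn_banach_point_closed (𝕜 := 𝕜)
    (K.restrictScalars ℝ).convex (LinearMap.range T.toLinearMap).isClosed_topologicalClosure hyK
  have hTK : ∀ x, T x ∈ K := fun x => Submodule.le_topologicalClosure _ ⟨x, rfl⟩
  have hc : c < 0 := by simpa using hgt 0 K.zero_mem
  have hb : b = 0 := by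
    refine hT b fun x => ?_
    by_contra hne
    -- A functional bounded below on a subspace vanishes there: rescale `T x` to the value `c`.
    have := hgt (T (((c : 𝕜) * (b (T x))⁻¹) • x)) (hTK _)
    rw [map_smul, map_smul, smul_eq_mul, mul_assoc, inv_mul_cancel₀ hne, mul_one,
      RCLike.ofReal_re] at this
    exact lt_irrefl _ this
  rw [hb, zero_apply, map_zero] at hlt
  exact lt_asymm hc hlt

/-- A continuous linear map from a complete space to a metrizable locally convex space is surjective
if its transpose `b ↦ b ∘ T` is bijective. -/
theorem surjective_of_dual_bijective [UniformSpace E] [IsUniformAddGroup E] [CompleteSpace E]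
    [UniformSpace F] [IsUniformAddGroup F] [T2Space F] [ContinuousSMul 𝕜 F]
    [FirstCountableTopology F] [Module ℝ F] [IsScalarTower ℝ 𝕜 F] [LocallyConvexSpace ℝ F]
    {p : SeminormFamily 𝕜 E ι} (hp : WithSeminorms p) (T : E →L[𝕜] F)
    (hinj : ∀ b : F →L[𝕜] 𝕜, (∀ x, b (T x) = 0) → b = 0)
    (hsurj : ∀ a : E →L[𝕜] 𝕜, ∃ b : F →L[𝕜] 𝕜, ∀ x, b (T x) = a x) :
    Function.Surjective T := by
  have hind : IsUniformInducing T :=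
    AddMonoidHom.isUniformInducing_of_isInducing (T.isInducing_of_dual_surjective hp hsurj)
  rw [← Set.range_eq_univ, ← hind.isComplete_range.isClosed.closure_eq]
  exact (T.denseRange_of_dual_injective hinj).closure_range

end ContinuousLinearMap

/-! ### Multipliers of the Schwartz space -/

namespace SchwartzFamily

variable {𝕜 : Type*} [RCLike 𝕜] {m n : ℕ}

/-- The family `(δ_p)_p` of Dirac distributions on `ℝᵐ`, whose operator is the identity. -/
noncomputable def dirac (𝕜 : Type*) [RCLike 𝕜] (m : ℕ) : SchwartzFamily 𝕜 m m where
  toFun p := ContinuousLinearMap.toPointwiseConvergenceCLM _ _ _ _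
    ((BoundedContinuousFunction.evalCLM 𝕜 p).comp
      (SchwartzMap.toBoundedContinuousFunctionCLM 𝕜 (EuclideanSpace ℝ (Fin m)) 𝕜))
  exists_schwartz φ := ⟨φ, fun _ => rfl⟩

/-- The operator of multiplication by `f ∈ 𝒪_M` on the Schwartz space, as the operator of the family
`(f(p) δ_p)_p`. Its continuity is that of the operator of a family. -/
noncomputable def mulOperator (f : multiplierAlgebra 𝕜 m) : TestSpace 𝕜 m →L[𝕜] TestSpace 𝕜 m :=
  (f • dirac 𝕜 m).hat

theorem mulOperator_apply (f : multiplierAlgebra 𝕜 m) (φ : TestSpace 𝕜 m)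
    (p : EuclideanSpace ℝ (Fin m)) : mulOperator f φ p = f.1 p * φ p :=
  hat_apply _ _ _

theorem mulOperator_mulOperator_of_mul_eq_one {f g : multiplierAlgebra 𝕜 m} (h : f * g = 1)
    (φ : TestSpace 𝕜 m) : mulOperator f (mulOperator g φ) = φ := by
  ext p
  have hp : f.1 p * g.1 p = 1 := congrFun (congrArg Subtype.val h) p
  rw [mulOperator_apply, mulOperator_apply, ← mul_assoc, hp, one_mul]

theorem smul_hat (f : multiplierAlgebra 𝕜 m) (v : SchwartzFamily 𝕜 m n) (φ : TestSpace 𝕜 n) :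
    (f • v).hat φ = mulOperator f (v.hat φ) := by
  ext p
  rw [hat_apply, mulOperator_apply, hat_apply, smul_toFun]
  rfl

/-- The superposition operator of `f • v` is that of `v` after the transpose `a ↦ a ∘ M_f` of the
operator of multiplication by `f`; the latter is the superposition operator of `(f(p) δ_p)_p`. -/
theorem superposition_smul (f : multiplierAlgebra 𝕜 m) (v : SchwartzFamily 𝕜 m n)
    (a : TempDist 𝕜 m) :
    (f • v).superposition a = v.superposition ((f • dirac 𝕜 m).superposition a) := by
  ext φ
  rw [superposition_apply_apply, superposition_apply_apply, superposition_apply_apply, smul_hat]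
  rfl

/-- If the transpose of the operator of multiplication by `f` is bijective, then `f` is invertible
in `𝒪_M`. -/
theorem isUnit_of_transpose_bijective (f : multiplierAlgebra 𝕜 m)
    (hinj : ∀ b : TempDist 𝕜 m, (∀ φ, b (mulOperator f φ) = 0) → b = 0)
    (hsurj : ∀ a : TempDist 𝕜 m, ∃ b : TempDist 𝕜 m, ∀ φ, b (mulOperator f φ) = a φ) :
    IsUnit f := by
  have : FirstCountableTopology (TestSpace 𝕜 m) :=
    (schwartz_withSeminorms 𝕜 (EuclideanSpace ℝ (Fin m)) 𝕜).firstCountableTopology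
  have hM : Function.Surjective (mulOperator f) := by
    refine ContinuousLinearMap.surjective_of_dual_bijective
      (schwartz_withSeminorms 𝕜 (EuclideanSpace ℝ (Fin m)) 𝕜) _ (fun b hb => ?_) (fun a => ?_)
    · exact hinj (ContinuousLinearMap.toPointwiseConvergenceCLM _ _ _ _ b) hb
    · exact hsurj (ContinuousLinearMap.toPointwiseConvergenceCLM _ _ _ _ a)
  have hf : ∀ p, f.1 p ≠ 0 := by
    intro p hp
    let B : ContDiffBump p := default
    have hBc : HasCompactSupport fun q => ((B q : ℝ) : 𝕜) :=
      B.hasCompactSupport.comp_left (g := fun t : ℝ => (t : 𝕜)) RCLike.ofReal_zero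
    have hBs : ContDiff ℝ ∞ fun q => ((B q : ℝ) : 𝕜) :=
      (RCLike.ofRealCLM (K := 𝕜)).contDiff.comp B.contDiff
    obtain ⟨ψ, hψ⟩ := hM (hBc.toSchwartzMap hBs)
    have hψp := mulOperator_apply f ψ p
    rw [hp, zero_mul, hψ] at hψp
    have hB : ((B p : ℝ) : 𝕜) = 0 := hψp
    rw [B.one_of_mem_closedBall (Metric.mem_closedBall_self B.rIn_pos.le), RCLike.ofReal_one] at hB
    exact one_ne_zero hB
  have hg : f.1⁻¹ ∈ multiplierAlgebra 𝕜 m := by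
    refine ⟨f.2.1.inv hf, fun φ => ?_⟩
    obtain ⟨ψ, rfl⟩ := hM φ
    refine ⟨ψ, fun p => ?_⟩
    rw [mulOperator_apply, Pi.inv_apply, inv_mul_cancel_left₀ (hf p)]
  exact IsUnit.of_mul_eq_one ⟨f.1⁻¹, hg⟩ (Subtype.ext (funext fun p => mul_inv_cancel₀ (hf p)))

end SchwartzFamily

/-! ### Bases -/

open SchwartzFamily in
theorem mainTheorem4 {𝕜 : Type*} [RCLike 𝕜] {m n : ℕ}
    (V : Submodule 𝕜 (TempDist 𝕜 n)) (hV : IsClosed (V : Set (TempDist 𝕜 n)))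
    (e : SchwartzFamily 𝕜 m n) (he : e.IsSBasis V)
    (f : multiplierAlgebra 𝕜 m) :
    (f • e).IsSBasis V ↔ IsUnit f := by
  obtain ⟨hind, rfl⟩ := he
  constructor
  · rintro ⟨hind', hspan⟩
    refine isUnit_of_transpose_bijective f (fun b hb => hind' b ?_) (fun a => ?_)
    · ext φ
      rw [superposition_apply_apply, smul_hat, hb]
      rfl
    · have ha : e.superposition a ∈ (f • e).sSpan := hspan ▸ ⟨a, rfl⟩
      obtain ⟨b, hb⟩ := ha
      replace hb : (f • e).superposition b = e.superposition a := hb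
      have h0 := hind ((f • dirac 𝕜 m).superposition b - a) (by
        rw [map_sub, ← superposition_smul, hb, sub_self])
      exact ⟨b, fun φ => DFunLike.congr_fun (sub_eq_zero.1 h0) φ⟩
  · intro hf
    obtain ⟨g, hfg⟩ := hf.exists_right_inv
    have hgf : g * f = 1 := by rw [mul_comm, hfg]
    refine ⟨fun a ha => ?_, le_antisymm ?_ ?_⟩
    · have h0 := hind _ ((superposition_smul f e a).symm.trans ha)
      ext φ
      rw [← mulOperator_mulOperator_of_mul_eq_one hfg φ]
      exact DFunLike.congr_fun h0 (mulOperator g φ)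
    · rintro _ ⟨a, rfl⟩
      exact ⟨_, (superposition_smul f e a).symm⟩
    · rintro _ ⟨a, rfl⟩
      refine ⟨(g • dirac 𝕜 m).superposition a, ?_⟩
      ext φ
      change a (mulOperator g ((f • e).hat φ)) = a (e.hat φ)
      rw [smul_hat, mulOperator_mulOperator_of_mul_eq_one hgf]
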